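/- Let $n\ge 1$, work in $\mathbb{C}[x_1,\dots,x_n]$, and put $\partial_i=\partial/\partial x_i$, $\nabla_k=\sum_{i=1}^n\partial_i^k$, $\widetilde D_k=\sum_{i=1}^n x_i\partial_i^{k+1}$, $\partial^\alpha=\partial_1^{\alpha_1}\cdots\partial_n^{\alpha_n}$ for $\alpha\in\mathbb{N}^n$, and let $v_i\in\mathbb N^n$ be the $i$-th unit vector. Let $\Delta=\prod_{1\le i<j\le n}(x_i-x_j)$ and $\Delta^{(1)}=\prod_{2\le i<j\le n}(x_i-x_j)$. Write $e_k^{(j)}$ for the elementary symmetric polynomial of degree $k$ in the variables $x_i$ with $i\ne j$ (zero for $k<0$), and $e_k=e_k^{(1)}$. A polynomial $f$ is *$\mathfrak S_n$-harmonic* if $\nabla_kf=0$ for all $k\ge1$. Call $f_1$ a *first-order lift* of $f_0$ if $\nabla_kf_1=-\widetilde D_kf_0$ for $k=1,2$. Then: 1. Every $\mathfrak S_n$-harmonic $f_0$ has a first-order lift $f_1\in\mathbb{C}[x_1,\dots,x_n]$. 2. The polynomials $\partial^\alpha\Delta$, $\alpha\in\mathbb N^n$, span the space of $\mathfrak S_n$-harmonics.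 3. For all $k\ge 0$ and $\alpha$, $[\widetilde D_k,\partial^\alpha]=-\sum_{\alpha_i\ne0}\alpha_i\,\partial^{\alpha+kv_i}$. For $k\ge1$, $\widetilde D_k\Delta=0$, and hence $$-\widetilde D_k\partial^\alpha\Delta=\sum_{\alpha_i\neq 0}\alpha_i\,\partial^{\alpha+kv_i}\Delta=\sum_{\alpha_i\neq 0}\alpha_i\,\partial^{\alpha-v_i}(\partial_i^{k+1}\Delta).$$ 4. If $f$ is a first-order lift of $\partial_1\Delta$, then for every permutation $\sigma\in\mathfrak S_n$ the polynomial $\operatorname{sgn}(\sigma)\,f(x_{\sigma(1)},\dots,x_{\sigma(n)})$ is a first-order lift of $\partial_{\sigma(1)}\Delta$. If $f_1^{(i)}$ is a first-order lift of $\partial_i\Delta$ for each $i=1,\dots,n$, then for every $\alpha$ the polynomial $\sum_{\alpha_i\ne0}\alpha_i\,\partial^{\alpha-v_i}f_1^{(i)}$ is a first-order lift of $\partial^\alpha\Delta$. 5. For all $c,d\in\mathbb C$ there are $a,b\in\mathbb C$ such that for every $j\in\{1,\dots,n\}$ and every $\alpha$ the polynomial $f_1=(a x_j+b\,e_1^{(j)})\,\partial^\alpha\Delta$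 satisfies $\nabla_1f_1=c\,\partial^\alpha\Delta$ and $\nabla_2f_1=d\,\partial_j\partial^\alpha\Delta$. 6. The polynomial $$\Delta^{(1)}\sum_{s=0}^{n-2}\frac{(-1)^{n-2-s}}{n}\left((n+1)\binom{s+1}{2}e_{n-2-s}-\binom{s+2}{2}e_{n-3-s}\,e_1\right)x_1^s$$ is a first-order lift of $\partial_1\Delta$ (the sum being empty for $n=1$). -/

import Mathlib

noncomputable section

namespace QHarmonic

open MvPolynomial

/-- The partial derivative `∂ᵢ` as an endomorphism of `ℂ[x₁, …, xₙ]`. -/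
def del {n : ℕ} (i : Fin n) : Module.End ℂ (MvPolynomial (Fin n) ℂ) :=
  (pderiv i).toLinearMap

/-- `∂^α = ∂₁^{α₁} ∂₂^{α₂} ⋯ ∂ₙ^{αₙ}`. -/
def delPow {n : ℕ} (α : Fin n → ℕ) : Module.End ℂ (MvPolynomial (Fin n) ℂ) :=
  (List.ofFn fun i => del i ^ α i).prod

/-- The generalized laplacian `∇ₖ = ∑ᵢ ∂ᵢᵏ`. -/
def nabla (n k : ℕ) : Module.End ℂ (MvPolynomial (Fin n) ℂ) :=
  ∑ i, del i ^ k

/-- The operator `D̃ₖ = ∑ᵢ xᵢ ∂ᵢᵏ⁺¹`. -/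
def dTilde (n k : ℕ) : Module.End ℂ (MvPolynomial (Fin n) ℂ) :=
  ∑ i, LinearMap.mulLeft ℂ (X i) * del i ^ (k + 1)

/-- The `𝔖ₙ`-harmonic polynomials: those killed by `∇ₖ` for every `k ≥ 1`. -/
def harmonics (n : ℕ) : Submodule ℂ (MvPolynomial (Fin n) ℂ) :=
  ⨅ k ∈ Set.Ici 1, LinearMap.ker (nabla n k)

/-- The Vandermonde product `∏_{i < j} (xᵢ - xⱼ)` in the variables indexed by `S`. -/
def vander {n : ℕ} (S : Finset (Fin n)) : MvPolynomial (Fin n) ℂ :=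
  ∏ i ∈ S, ∏ j ∈ S with i < j, (X i - X j)

/-- The Vandermonde determinant `Δ` in all the variables. -/
def Delta (n : ℕ) : MvPolynomial (Fin n) ℂ := vander Finset.univ

/-- The elementary symmetric polynomial `eₖ` in the variables `xᵢ`, `i ≠ j`,
with `eₖ = 0` for `k < 0`. -/
def elem {n : ℕ} (j : Fin n) (k : ℤ) : MvPolynomial (Fin n) ℂ :=
  if k < 0 then 0 else ∑ T ∈ (Finset.univ.erase j).powersetCard k.toNat, ∏ i ∈ T, X i

/-- `f₁` is a first-order lift of `f₀`: `∇ₖ f₁ = -D̃ₖ f₀` for `k = 1, 2`. -/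
def IsFirstOrderLift {n : ℕ} (f₀ f₁ : MvPolynomial (Fin n) ℂ) : Prop :=
  ∀ k ∈ ({1, 2} : Set ℕ), nabla n k f₁ = -dTilde n k f₀

/-- The explicit polynomial
`Δ⁽¹⁾ ∑_{s=0}^{n-2} (-1)^{n-2-s}/n ((n+1) C(s+1,2) e_{n-2-s} - C(s+2,2) e_{n-3-s} e₁) x₁ˢ`,
where `Δ⁽¹⁾` and the `eₖ` are in the variables `x₂, …, xₙ` (the variable `x₁` has index `0`). -/
def explicitLift (n : ℕ) [NeZero n] : MvPolynomial (Fin n) ℂ :=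
  vander (Finset.univ.erase (0 : Fin n)) *
    ∑ s ∈ Finset.range (n - 1),
      C ((-1 : ℂ) ^ (n - 2 - s) / (n : ℂ)) *
        (C (((n + 1) * (s + 1).choose 2 : ℕ) : ℂ) * elem (0 : Fin n) ((n : ℤ) - 2 - s)
          - C (((s + 2).choose 2 : ℕ) : ℂ) * elem (0 : Fin n) ((n : ℤ) - 3 - s)
            * elem (0 : Fin n) 1) *
        X 0 ^ s

end QHarmonic

end

noncomputable section

namespace QHarmonic

open MvPolynomial

variable {n : ℕ}

/-! The homomorphism f ↦ f(∂) (`polyDel`) turns the operators into algebra: ∇ₖ is pₖ(∂) for the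
power sum pₖ, and [xᵢ, f(∂)] = -(∂ᵢf)(∂) yields the commutator with D̃ₖ. For k ≥ 1, ∇ₖΔ and D̃ₖΔ are
antisymmetric, hence multiples of Δ, but of lower degree, hence zero.

Spanning is duality for the pairing of f and g given by f(∂)g at 0. With I the ideal of the pₖ, k ≥
1, it reduces to: f(∂)Δ = 0 forces f ∈ I (`mem_psumIdeal_of_polyDel_Delta_eq_zero`). Since I
contains a power of the ideal (x₁, …, xₙ), descending induction applies: if all (xᵢ - xⱼ)f lie in I,
then f is antisymmetric modulo I, so f ≡ cΔ, and Δ(∂)Δ ≠ 0 gives c = 0.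

A lift of ∂ᵢΔ is an f with ∇ₖf = ∂ᵢᵏ⁺¹Δ for k = 1, 2. One lift of ∂₁Δ gives all others by
permutation, differentiation and linearity. Such a lift is (a x₁ + b e₁)∂₁²Δ: ∇₁ and ∇₂ send it to
(a + (n-1)b)∂₁²Δ and 2(a - b)∂₁³Δ, so a = (n+1)/(2n), b = 1/(2n) work. Expanding ∂₁²Δ in powers of
x₁ gives the explicit formula. -/

/-! ### Constant-coefficient differential operators and commutators -/

theorem del_apply (i : Fin n) (f : MvPolynomial (Fin n) ℂ) : del i f = pderiv i f :=
  rfl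

theorem del_commute (i j : Fin n) : del i * del j = del j * del i := by
  ext1 m
  ext d
  simp only [LinearMap.comp_apply, Module.End.mul_apply, del_apply, coeff_pderiv,
    Finsupp.add_apply, add_assoc]
  rw [add_comm (Finsupp.single i 1) (Finsupp.single j 1)]
  rcases eq_or_ne i j with rfl | h
  · ring
  · rw [Finsupp.single_eq_of_ne h, Finsupp.single_eq_of_ne h.symm]
    push_cast
    ring

open scoped IsMulCommutative in
-- `aeval` needs a commutative target, so it is taken in the subalgebra generated by the ∂ᵢ.
theorem exists_polyDel (n : ℕ) :
    ∃ Φ : MvPolynomial (Fin n) ℂ →ₐ[ℂ] Module.End ℂ (MvPolynomial (Fin n) ℂ),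
      ∀ i, Φ (X i) = del i := by
  let s : Set (Module.End ℂ (MvPolynomial (Fin n) ℂ)) := Set.range del
  have hs : ∀ a ∈ s, ∀ b ∈ s, a * b = b * a := by
    rintro _ ⟨i, rfl⟩ _ ⟨j, rfl⟩
    exact del_commute i j
  have := Algebra.isMulCommutative_adjoin ℂ hs
  let d : Fin n → Algebra.adjoin ℂ s := fun i => ⟨del i, Algebra.subset_adjoin ⟨i, rfl⟩⟩
  refine ⟨(Algebra.adjoin ℂ s).val.comp (aeval d), fun i => ?_⟩
  rw [AlgHom.comp_apply, aeval_X]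
  rfl

/-- Evaluation of a polynomial at the commuting operators `∂₁, …, ∂ₙ`. -/
def polyDel (n : ℕ) : MvPolynomial (Fin n) ℂ →ₐ[ℂ] Module.End ℂ (MvPolynomial (Fin n) ℂ) :=
  (exists_polyDel n).choose

@[simp]
theorem polyDel_X (i : Fin n) : polyDel n (X i) = del i :=
  (exists_polyDel n).choose_spec i

theorem polyDel_mul_comm (f g : MvPolynomial (Fin n) ℂ) :
    polyDel n f * polyDel n g = polyDel n g * polyDel n f := by
  rw [← map_mul, mul_comm, map_mul]

theorem polyDel_apply_comm (f g h : MvPolynomial (Fin n) ℂ) :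
    polyDel n f (polyDel n g h) = polyDel n g (polyDel n f h) :=
  LinearMap.congr_fun (polyDel_mul_comm f g) h

theorem delPow_eq_prod (α : Fin n → ℕ) : delPow α = polyDel n (∏ i, X i ^ α i) := by
  rw [← List.prod_ofFn, map_list_prod, List.map_ofFn, delPow]
  simp [Function.comp_def]

theorem delPow_eq (α : Fin n → ℕ) :
    delPow α = polyDel n (monomial (Finsupp.equivFunOnFinite.symm α) 1) := by
  rw [delPow_eq_prod, monomial_eq, Finsupp.prod_fintype _ _ (by simp)]
  simp

theorem delPow_coe (m : Fin n →₀ ℕ) : delPow m = polyDel n (monomial m 1) := by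
  rw [delPow_eq]
  simp

theorem nabla_eq (k : ℕ) : nabla n k = polyDel n (psum (Fin n) ℂ k) := by
  simp [nabla, psum]

theorem mulLeft_X_commutator (i : Fin n) (f : MvPolynomial (Fin n) ℂ) :
    LinearMap.mulLeft ℂ (X i) * polyDel n f - polyDel n f * LinearMap.mulLeft ℂ (X i) =
      -polyDel n (pderiv i f) := by
  induction f using MvPolynomial.induction_on with
  | C a =>
    rw [← algebraMap_eq, AlgHom.commutes, Algebra.commutes, sub_self, algebraMap_eq, pderiv_C,
      map_zero, neg_zero]
  | add p q hp hq =>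
    rw [map_add, map_add, map_add, neg_add, ← hp, ← hq, mul_add, add_mul]
    abel
  | mul_X p j hp =>
    have hj : LinearMap.mulLeft ℂ (X i) * del j - del j * LinearMap.mulLeft ℂ (X i) =
        -polyDel n (pderiv i (X j)) := by
      refine LinearMap.ext fun g => ?_
      simp only [LinearMap.sub_apply, Module.End.mul_apply, LinearMap.mulLeft_apply,
        del_apply, pderiv_mul, LinearMap.neg_apply]
      rcases eq_or_ne i j with rfl | h
      · simp
      · simp [pderiv_X_of_ne h, pderiv_X_of_ne h.symm]
    rw [pderiv_mul, map_add, map_mul, map_mul, map_mul, polyDel_X, neg_add,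
      ← neg_mul (polyDel n _), ← hp, ← mul_neg (polyDel n p), ← hj]
    rw [sub_mul, mul_sub]
    simp only [mul_assoc]
    abel

theorem dTilde_eq (k : ℕ) :
    dTilde n k = ∑ i, LinearMap.mulLeft ℂ (X i) * polyDel n (X i ^ (k + 1)) := by
  simp [dTilde]

theorem dTilde_commutator (k : ℕ) (f : MvPolynomial (Fin n) ℂ) :
    dTilde n k * polyDel n f - polyDel n f * dTilde n k =
      -∑ i, polyDel n (pderiv i f * X i ^ (k + 1)) := by
  rw [dTilde_eq, Finset.sum_mul, Finset.mul_sum, ← Finset.sum_sub_distrib,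
    ← Finset.sum_neg_distrib]
  refine Finset.sum_congr rfl fun i _ => ?_
  rw [map_mul, ← neg_mul (polyDel n _), ← mulLeft_X_commutator, sub_mul, mul_assoc,
    polyDel_mul_comm (X i ^ (k + 1)) f]
  simp only [mul_assoc]

theorem pderiv_monomial_mul_X_pow (k : ℕ) (m : Fin n →₀ ℕ) (i : Fin n) :
    pderiv i (monomial m (1 : ℂ)) * X i ^ (k + 1) =
      (m i : ℂ) • monomial (m + Finsupp.single i k) 1 := by
  rw [pderiv_monomial, X_pow_eq_monomial, monomial_mul, smul_monomial]
  -- The truncated exponent `m i - 1` is wrong only for `m i = 0`, where the coefficient vanishes.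
  rcases Nat.eq_zero_or_pos (m i) with h | h
  · simp [h]
  · congr 2
    · rw [add_comm k 1, Finsupp.single_add, ← add_assoc, tsub_add_cancel_of_le]
      simpa [Nat.one_le_iff_ne_zero] using h.ne'
    · simp

theorem equivFunOnFinite_symm_add_smul_single (k : ℕ) (α : Fin n → ℕ) (i : Fin n) :
    Finsupp.equivFunOnFinite.symm (α + k • Pi.single i 1) =
      Finsupp.equivFunOnFinite.symm α + Finsupp.single i k := by
  ext j
  rcases eq_or_ne j i with rfl | h
  · simp
  · simp [h]

theorem dTilde_delPow_commutator (k : ℕ) (α : Fin n → ℕ) :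
    dTilde n k * delPow α - delPow α * dTilde n k =
      -∑ i with α i ≠ 0, (α i : ℂ) • delPow (α + k • Pi.single i 1) := by
  rw [delPow_eq, dTilde_commutator, Finset.sum_filter_of_ne]
  · congr 1
    refine Finset.sum_congr rfl fun i _ => ?_
    rw [pderiv_monomial_mul_X_pow, map_smul, delPow_eq, equivFunOnFinite_symm_add_smul_single]
    simp
  · intro i _ h h0
    simp [h0] at h

theorem delPow_sub_single_mul_del_pow {α : Fin n → ℕ} {i : Fin n} (h : α i ≠ 0) (k : ℕ) :
    delPow (α - Pi.single i 1) * del i ^ (k + 1) = delPow (α + k • Pi.single i 1) := by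
  rw [delPow_eq, delPow_eq, ← polyDel_X, ← map_pow, ← map_mul, X_pow_eq_monomial, monomial_mul,
    mul_one]
  congr 3
  ext j
  rcases eq_or_ne j i with rfl | hj
  · simp
    omega
  · simp [hj]

/-! ### Vandermonde determinant and antisymmetric polynomials -/

theorem Delta_eq_det (n : ℕ) :
    Delta n = (Matrix.vandermonde fun i : Fin n => -(X i : MvPolynomial (Fin n) ℂ)).det := by
  rw [Matrix.det_vandermonde, Delta, vander]
  refine Finset.prod_congr rfl fun i _ => Finset.prod_congr ?_ fun j _ => by ring
  ext j
  simp

theorem Delta_eq_prod_pairs (n : ℕ) :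
    Delta n = ∏ p : Fin n × Fin n with p.1 < p.2, (X p.1 - X p.2) := by
  rw [Delta, vander, Finset.prod_filter, Fintype.prod_prod_type]
  exact Finset.prod_congr rfl fun i _ => Finset.prod_filter _ _

theorem Delta_ne_zero (n : ℕ) : Delta n ≠ 0 := by
  rw [Delta_eq_det, Matrix.det_vandermonde_ne_zero_iff]
  exact neg_injective.comp X_injective

/-- `f(x_{σ(1)}, …, x_{σ(n)}) = sgn(σ) f` for all permutations `σ`. -/
def IsAntisymm (f : MvPolynomial (Fin n) ℂ) : Prop :=
  ∀ σ : Equiv.Perm (Fin n), rename σ f = ((Equiv.Perm.sign σ : ℤ) : ℂ) • f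

theorem isAntisymm_Delta (n : ℕ) : IsAntisymm (Delta n) := by
  intro σ
  rw [Delta_eq_det, AlgHom.map_det, MvPolynomial.smul_eq_C_mul, map_intCast, ← Matrix.det_permute]
  congr 1
  ext1 i j
  simp [Matrix.vandermonde_apply]

theorem rename_del (σ : Equiv.Perm (Fin n)) (i : Fin n) (f : MvPolynomial (Fin n) ℂ) :
    rename σ (del i f) = del (σ i) (rename σ f) :=
  (pderiv_rename σ.injective i f).symm

theorem rename_del_pow (σ : Equiv.Perm (Fin n)) (i : Fin n) (k : ℕ)
    (f : MvPolynomial (Fin n) ℂ) :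
    rename σ ((del i ^ k) f) = (del (σ i) ^ k) (rename σ f) := by
  induction k generalizing f with
  | zero => rfl
  | succ k ih => rw [pow_succ, pow_succ, Module.End.mul_apply, ih, rename_del]; rfl

theorem nabla_apply (k : ℕ) (f : MvPolynomial (Fin n) ℂ) :
    nabla n k f = ∑ i, (del i ^ k) f := by
  simp [nabla]

theorem dTilde_apply (k : ℕ) (f : MvPolynomial (Fin n) ℂ) :
    dTilde n k f = ∑ i, X i * (del i ^ (k + 1)) f := by
  simp [dTilde]

theorem rename_nabla (σ : Equiv.Perm (Fin n)) (k : ℕ) (f : MvPolynomial (Fin n) ℂ) :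
    rename σ (nabla n k f) = nabla n k (rename σ f) := by
  simp only [nabla_apply, map_sum, rename_del_pow]
  exact Equiv.sum_comp σ fun i => (del i ^ k) (rename σ f)

theorem rename_dTilde (σ : Equiv.Perm (Fin n)) (k : ℕ) (f : MvPolynomial (Fin n) ℂ) :
    rename σ (dTilde n k f) = dTilde n k (rename σ f) := by
  simp only [dTilde_apply, map_sum, map_mul, rename_X, rename_del_pow]
  exact Equiv.sum_comp σ fun i => X i * (del i ^ (k + 1)) (rename σ f)

/-- Modulo xᵢ - xⱼ the transposition fixes every variable, hence every polynomial. -/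
theorem X_sub_X_dvd_sub_rename_swap (i j : Fin n) (f : MvPolynomial (Fin n) ℂ) :
    X i - X j ∣ f - rename (Equiv.swap i j) f := by
  rw [← Ideal.mem_span_singleton, ← Ideal.Quotient.eq]
  have h : (Ideal.Quotient.mkₐ ℂ (Ideal.span {(X i - X j : MvPolynomial (Fin n) ℂ)})) =
      (Ideal.Quotient.mkₐ ℂ (Ideal.span {(X i - X j : MvPolynomial (Fin n) ℂ)})).comp
        (rename (Equiv.swap i j)) := by
    have hij : (Ideal.Quotient.mk (Ideal.span {(X i - X j : MvPolynomial (Fin n) ℂ)})) (X i) =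
        Ideal.Quotient.mk _ (X j) :=
      Ideal.Quotient.eq.2 (Ideal.mem_span_singleton_self _)
    refine MvPolynomial.algHom_ext fun k => ?_
    rw [AlgHom.comp_apply, rename_X, Ideal.Quotient.mkₐ_eq_mk]
    rcases eq_or_ne k i with rfl | hi
    · rw [Equiv.swap_apply_left, hij]
    · rcases eq_or_ne k j with rfl | hj
      · rw [Equiv.swap_apply_right, hij]
      · rw [Equiv.swap_apply_of_ne_of_ne hi hj]
  exact DFunLike.congr_fun h f

theorem irreducible_X_sub_X {i j : Fin n} (h : i ≠ j) :
    Irreducible (X i - X j : MvPolynomial (Fin n) ℂ) := by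
  have := irreducible_mul_X_add (1 : MvPolynomial (Fin n) ℂ) (-X j) i one_ne_zero (by simp)
    (by simp [vars_neg, h]) isRelPrime_one_left
  rwa [one_mul, ← sub_eq_add_neg] at this

/-- Otherwise xₖ = xₗ on the whole hyperplane xᵢ = xⱼ; a unit vector at whichever of k, l lies
outside {i, j} refutes this. -/
theorem not_X_sub_X_dvd {i j k l : Fin n} (hij : i < j) (hkl : k < l)
    (h : (i, j) ≠ (k, l)) : ¬(X i - X j : MvPolynomial (Fin n) ℂ) ∣ X k - X l := by
  intro hd
  have key : ∀ v : Fin n → ℂ, v i = v j → v k = v l := fun v hv => by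
    have := map_dvd (aeval v) hd
    simpa [hv, sub_eq_zero] using this
  by_cases hk : k = i ∨ k = j
  · have hl : i ≠ l ∧ j ≠ l := by
      simp only [ne_eq, Prod.mk.injEq, not_and] at h
      constructor
      · rintro rfl
        rcases hk with rfl | rfl
        · exact lt_irrefl _ hkl
        · exact lt_asymm hij hkl
      · rintro rfl
        rcases hk with rfl | rfl
        · exact h rfl rfl
        · exact lt_irrefl _ hkl
    have := key (Pi.single l 1) (by simp [hl.1, hl.2])
    simp [hkl.ne] at this
  · rw [not_or] at hk
    have := key (Pi.single k 1) (by simp [Ne.symm hk.1, Ne.symm hk.2])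
    simp [hkl.ne'] at this

theorem IsAntisymm.X_sub_X_dvd {f : MvPolynomial (Fin n) ℂ} (hf : IsAntisymm f) {i j : Fin n}
    (h : i ≠ j) : X i - X j ∣ f := by
  have h2 := X_sub_X_dvd_sub_rename_swap i j f
  have h3 : f - rename (Equiv.swap i j) f = C 2 * f := by
    rw [hf, Equiv.Perm.sign_swap h, map_ofNat]
    simp
    ring
  rw [h3] at h2
  have := h2.mul_left (C (1 / 2 : ℂ))
  rwa [← mul_assoc, ← C_mul, one_div, inv_mul_cancel₀ two_ne_zero, C_1, one_mul] at this

/-- The factors xᵢ - xⱼ are irreducible and pairwise coprime, and each divides f. -/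
theorem IsAntisymm.Delta_dvd {f : MvPolynomial (Fin n) ℂ} (hf : IsAntisymm f) :
    Delta n ∣ f := by
  rw [Delta_eq_prod_pairs]
  refine Finset.prod_dvd_of_isRelPrime ?_ fun p hp => hf.X_sub_X_dvd ?_
  · intro p hp q hq hpq
    rw [Finset.mem_coe, Finset.mem_filter] at hp hq
    exact (irreducible_X_sub_X hp.2.ne).isRelPrime_iff_not_dvd.2
      (not_X_sub_X_dvd hp.2 hq.2 hpq)
  · exact (Finset.mem_filter.1 hp).2.ne

theorem IsAntisymm.nabla {f : MvPolynomial (Fin n) ℂ} (hf : IsAntisymm f) (k : ℕ) :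
    IsAntisymm (nabla n k f) := fun σ => by
  rw [rename_nabla, hf, map_smul]

theorem IsAntisymm.dTilde {f : MvPolynomial (Fin n) ℂ} (hf : IsAntisymm f) (k : ℕ) :
    IsAntisymm (dTilde n k f) := fun σ => by
  rw [rename_dTilde, hf, map_smul]

/-- All monomials of `f` have degree at most `d - r` (none, if `d < r`). -/
def DegreeDrop (d r : ℕ) (f : MvPolynomial (Fin n) ℂ) : Prop :=
  ∀ m ∈ f.support, m.degree + r ≤ d

theorem DegreeDrop.del {d r : ℕ} {f : MvPolynomial (Fin n) ℂ} (hf : DegreeDrop d r f)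
    (i : Fin n) : DegreeDrop d (r + 1) (del i f) := by
  intro m hm
  rw [mem_support_iff, del_apply, coeff_pderiv] at hm
  have := hf _ (mem_support_iff.2 (left_ne_zero_of_mul hm))
  rw [map_add, Finsupp.degree_single] at this
  omega

theorem DegreeDrop.del_pow {d r : ℕ} {f : MvPolynomial (Fin n) ℂ} (hf : DegreeDrop d r f)
    (i : Fin n) (k : ℕ) : DegreeDrop d (r + k) ((QHarmonic.del i ^ k) f) := by
  induction k with
  | zero => exact hf
  | succ k ih => rw [pow_succ']; exact ih.del i

theorem DegreeDrop.X_mul {d r : ℕ} {f : MvPolynomial (Fin n) ℂ} (hf : DegreeDrop d (r + 1) f)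
    (i : Fin n) : DegreeDrop d r (X i * f) := by
  intro m hm
  rw [support_X_mul, Finset.mem_map] at hm
  obtain ⟨m', hm', rfl⟩ := hm
  have := hf _ hm'
  rw [addLeftEmbedding_apply, map_add, Finsupp.degree_single]
  omega

theorem DegreeDrop.sum {d r : ℕ} {ι : Type*} {s : Finset ι} {f : ι → MvPolynomial (Fin n) ℂ}
    (hf : ∀ i ∈ s, DegreeDrop d r (f i)) : DegreeDrop d r (∑ i ∈ s, f i) := by
  classical
  intro m hm
  obtain ⟨i, hi, hm⟩ := Finset.mem_biUnion.1 (support_sum hm)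
  exact hf i hi m hm

theorem degreeDrop_self (f : MvPolynomial (Fin n) ℂ) : DegreeDrop f.totalDegree 0 f :=
  fun _ hm => le_totalDegree hm

theorem IsAntisymm.eq_zero_of_degreeDrop {f : MvPolynomial (Fin n) ℂ} (hf : IsAntisymm f)
    {r : ℕ} (hr : 1 ≤ r) (h : DegreeDrop (Delta n).totalDegree r f) : f = 0 := by
  by_contra h0
  obtain ⟨g, rfl⟩ := hf.Delta_dvd
  have hg := right_ne_zero_of_mul h0
  have hd := totalDegree_mul_of_isDomain (Delta_ne_zero n) hg
  obtain ⟨m, hm, hmd⟩ := Finset.exists_mem_eq_sup _ (support_nonempty.2 h0) Finsupp.degree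
  have := h m hm
  rw [← hmd] at this
  change (Delta n * g).totalDegree + r ≤ _ at this
  omega

theorem nabla_Delta {k : ℕ} (hk : 1 ≤ k) : nabla n k (Delta n) = 0 := by
  refine ((isAntisymm_Delta n).nabla k).eq_zero_of_degreeDrop hk ?_
  rw [nabla_apply]
  refine .sum fun i _ => ?_
  simpa using (degreeDrop_self (Delta n)).del_pow i k

/-- D̃ₖ lowers degree by k: k + 1 derivatives against one multiplication by xᵢ. -/
theorem dTilde_Delta {k : ℕ} (hk : 1 ≤ k) : dTilde n k (Delta n) = 0 := by
  refine ((isAntisymm_Delta n).dTilde k).eq_zero_of_degreeDrop hk ?_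
  rw [dTilde_apply]
  refine .sum fun i _ => DegreeDrop.X_mul ?_ i
  simpa using (degreeDrop_self (Delta n)).del_pow i (k + 1)

/-! ### The ideal of positive power sums -/

/-- The ideal generated by the power sums of positive degree. -/
def psumIdeal (n : ℕ) : Ideal (MvPolynomial (Fin n) ℂ) :=
  Ideal.span (psum (Fin n) ℂ '' Set.Ici 1)

theorem psum_mem_psumIdeal {k : ℕ} (hk : 1 ≤ k) : psum (Fin n) ℂ k ∈ psumIdeal n :=
  Ideal.subset_span ⟨k, hk, rfl⟩

/-- Newton's identities, with division by k. -/
theorem esymm_mem_psumIdeal {k : ℕ} (hk : 1 ≤ k) : esymm (Fin n) ℂ k ∈ psumIdeal n := by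
  have h : (k : MvPolynomial (Fin n) ℂ) * esymm (Fin n) ℂ k ∈ psumIdeal n := by
    rw [mul_esymm_eq_sum]
    refine Ideal.mul_mem_left _ _ (Ideal.sum_mem _ fun a ha => Ideal.mul_mem_left _ _ ?_)
    rw [Finset.mem_filter, Finset.HasAntidiagonal.mem_antidiagonal] at ha
    exact psum_mem_psumIdeal (by omega)
  have := Ideal.mul_mem_left _ (C (k : ℂ)⁻¹) h
  rwa [← map_natCast (C : ℂ →+* MvPolynomial (Fin n) ℂ), ← mul_assoc, ← C_mul,
    inv_mul_cancel₀ (Nat.cast_ne_zero.2 (by omega)), C_1, one_mul] at this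

theorem IsSymmetric.exists_sub_C_mem_psumIdeal {p : MvPolynomial (Fin n) ℂ}
    (hp : p.IsSymmetric) : ∃ c : ℂ, p - C c ∈ psumIdeal n := by
  obtain ⟨q, hq⟩ := esymmAlgHom_surjective ℂ (Fintype.card_fin n).le ⟨p, hp⟩
  have hq' : aeval (fun i : Fin n => esymm (Fin n) ℂ (i + 1)) q = p := by
    have := congrArg Subtype.val hq
    rwa [esymmAlgHom_apply] at this
  refine ⟨constantCoeff q, ?_⟩
  subst hq'
  clear hq hp
  induction q using MvPolynomial.induction_on with
  | C a => simp
  | add p q hp hq =>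
    rw [map_add, map_add, map_add, add_sub_add_comm]
    exact add_mem hp hq
  | mul_X p i _ =>
    rw [map_mul, map_mul, aeval_X, constantCoeff_X, mul_zero, map_zero, sub_zero]
    exact Ideal.mul_mem_left _ _ (esymm_mem_psumIdeal (by omega))

/-- xᵢ is a root of ∏ⱼ(t - xⱼ), whose lower coefficients are ±eₖ with k ≥ 1. -/
theorem X_pow_mem_psumIdeal (i : Fin n) : X i ^ n ∈ psumIdeal n := by
  have h := congrArg (Polynomial.eval (X i : MvPolynomial (Fin n) ℂ))
    (Multiset.prod_X_sub_X_eq_sum_esymm (Finset.univ.val.map (X : Fin n → MvPolynomial (Fin n) ℂ)))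
  rw [Finset.sum_range_succ', Polynomial.eval_add, Multiset.map_map] at h
  have h0 : Polynomial.eval (X i : MvPolynomial (Fin n) ℂ)
      (∏ j : Fin n, (Polynomial.X - Polynomial.C (X j))) = 0 := by
    rw [Polynomial.eval_prod]
    exact Finset.prod_eq_zero (Finset.mem_univ i) (by simp)
  erw [h0] at h
  simp only [Multiset.card_map, Finset.card_val, Finset.card_univ, Fintype.card_fin,
    ← esymm_eq_multiset_esymm, Polynomial.eval_finsetSum, Polynomial.eval_mul,
    Polynomial.eval_pow, Polynomial.eval_neg, Polynomial.eval_one, Polynomial.eval_C,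
    Polynomial.eval_X, esymm_zero, pow_zero, one_mul, tsub_zero] at h
  rw [eq_neg_of_add_eq_zero_right h.symm]
  exact neg_mem (Ideal.sum_mem _ fun k _ =>
    Ideal.mul_mem_left _ _ (Ideal.mul_mem_right _ _ (esymm_mem_psumIdeal (by omega))))

theorem exists_span_X_pow_le_psumIdeal (n : ℕ) :
    ∃ N, Ideal.span (Set.range (X : Fin n → MvPolynomial (Fin n) ℂ)) ^ N ≤ psumIdeal n := by
  refine Ideal.exists_pow_le_of_le_radical_of_fg ?_ ⟨Finset.univ.image X, by simp⟩
  rw [Ideal.span_le]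
  rintro _ ⟨i, rfl⟩
  exact ⟨n, X_pow_mem_psumIdeal i⟩

theorem rename_mem_psumIdeal (σ : Equiv.Perm (Fin n)) {f : MvPolynomial (Fin n) ℂ}
    (hf : f ∈ psumIdeal n) : rename σ f ∈ psumIdeal n := by
  suffices psumIdeal n ≤ (psumIdeal n).comap (rename σ) from this hf
  rw [psumIdeal, Ideal.span_le]
  rintro _ ⟨k, hk, rfl⟩
  rw [SetLike.mem_coe, Ideal.mem_comap, psum_isSymmetric (Fin n) ℂ k σ]
  exact psum_mem_psumIdeal hk

/-- The divided difference preserves the ideal: it kills the symmetric generators and obeys a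
twisted Leibniz rule. -/
theorem exists_sub_rename_swap_eq {f : MvPolynomial (Fin n) ℂ} (hf : f ∈ psumIdeal n)
    (i j : Fin n) :
    ∃ h ∈ psumIdeal n, f - rename (Equiv.swap i j) f = (X i - X j) * h := by
  induction hf using Submodule.span_induction with
  | mem x hx =>
    obtain ⟨k, _, rfl⟩ := hx
    exact ⟨0, zero_mem _, by rw [psum_isSymmetric (Fin n) ℂ k, sub_self, mul_zero]⟩
  | zero => exact ⟨0, zero_mem _, by simp⟩
  | add x y _ _ hx hy =>
    obtain ⟨u, hu, hxu⟩ := hx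
    obtain ⟨v, hv, hyv⟩ := hy
    exact ⟨u + v, add_mem hu hv, by rw [map_add, add_sub_add_comm, hxu, hyv, mul_add]⟩
  | smul a x hx ih =>
    obtain ⟨u, hu, hxu⟩ := ih
    obtain ⟨b, hb⟩ := X_sub_X_dvd_sub_rename_swap i j a
    refine ⟨a * u + b * rename (Equiv.swap i j) x, add_mem (Ideal.mul_mem_left _ _ hu)
      (Ideal.mul_mem_left _ _ (rename_mem_psumIdeal _ hx)), ?_⟩
    rw [smul_eq_mul, map_mul]
    linear_combination a * hxu + rename (Equiv.swap i j) x * hb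

/-- The divided difference of (xᵢ - xⱼ)f is f plus its transpose. -/
theorem add_rename_swap_mem_psumIdeal {f : MvPolynomial (Fin n) ℂ} {i j : Fin n} (hij : i ≠ j)
    (hf : (X i - X j) * f ∈ psumIdeal n) : f + rename (Equiv.swap i j) f ∈ psumIdeal n := by
  obtain ⟨h, hh, he⟩ := exists_sub_rename_swap_eq hf i j
  have : f + rename (Equiv.swap i j) f = h := by
    refine mul_left_cancel₀ (irreducible_X_sub_X hij).ne_zero ?_
    rw [← he, map_mul, map_sub, rename_X, rename_X, Equiv.swap_apply_left,
      Equiv.swap_apply_right]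
    ring
  rwa [this]

/-- The antisymmetrization `∑_σ sgn(σ) f(x_{σ(1)}, …, x_{σ(n)})`. -/
def antisymm (f : MvPolynomial (Fin n) ℂ) : MvPolynomial (Fin n) ℂ :=
  ∑ σ : Equiv.Perm (Fin n), ((Equiv.Perm.sign σ : ℤ) : ℂ) • rename σ f

theorem sign_smul_sign_smul (σ : Equiv.Perm (Fin n)) (f : MvPolynomial (Fin n) ℂ) :
    ((Equiv.Perm.sign σ : ℤ) : ℂ) • ((Equiv.Perm.sign σ : ℤ) : ℂ) • f = f := by
  rw [smul_smul, ← Int.cast_mul, ← Units.val_mul, Int.units_mul_self, Units.val_one,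
    Int.cast_one, one_smul]

theorem isAntisymm_antisymm (f : MvPolynomial (Fin n) ℂ) : IsAntisymm (antisymm f) := by
  intro τ
  rw [antisymm, map_sum, Finset.smul_sum, ← Equiv.sum_comp (Equiv.mulLeft τ) fun σ =>
    ((Equiv.Perm.sign τ : ℤ) : ℂ) • ((Equiv.Perm.sign σ : ℤ) : ℂ) • rename σ f]
  refine Finset.sum_congr rfl fun σ _ => ?_
  rw [map_smul, rename_rename, Equiv.coe_mulLeft, Equiv.Perm.sign_mul, Units.val_mul,
    Int.cast_mul, mul_smul, sign_smul_sign_smul]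
  rfl

theorem smul_rename_sub_mem_psumIdeal {f : MvPolynomial (Fin n) ℂ}
    (hf : ∀ i j : Fin n, i ≠ j → f + rename (Equiv.swap i j) f ∈ psumIdeal n)
    (σ : Equiv.Perm (Fin n)) :
    ((Equiv.Perm.sign σ : ℤ) : ℂ) • rename σ f - f ∈ psumIdeal n := by
  induction σ using Equiv.Perm.swap_induction_on with
  | one => simp
  | swap_mul σ i j hij ih =>
    have h := add_mem (rename_mem_psumIdeal (Equiv.swap i j) ih) (hf i j hij)
    rw [map_sub, map_smul, rename_rename, sub_add_add_cancel] at h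
    · rw [Equiv.Perm.sign_mul, Equiv.Perm.sign_swap hij, neg_one_mul, Units.val_neg,
        Int.cast_neg, neg_smul, ← neg_add']
      exact neg_mem (by rwa [add_comm] at h ⊢)

/-- Modulo the ideal, n! f equals its antisymmetrization Δp; the quotient p is symmetric, so
congruent to a constant. -/
theorem exists_sub_smul_Delta_mem_psumIdeal {f : MvPolynomial (Fin n) ℂ}
    (hf : ∀ i j : Fin n, i ≠ j → (X i - X j) * f ∈ psumIdeal n) :
    ∃ c : ℂ, f - c • Delta n ∈ psumIdeal n := by
  have h1 : antisymm f - (n.factorial : ℂ) • f ∈ psumIdeal n := by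
    have : antisymm f - (n.factorial : ℂ) • f = ∑ σ : Equiv.Perm (Fin n),
        (((Equiv.Perm.sign σ : ℤ) : ℂ) • rename σ f - f) := by
      rw [Finset.sum_sub_distrib, antisymm, Finset.sum_const, Finset.card_univ,
        Fintype.card_perm, Fintype.card_fin, Nat.cast_smul_eq_nsmul]
    rw [this]
    exact Ideal.sum_mem _ fun σ _ => smul_rename_sub_mem_psumIdeal
      (fun i j hij => add_rename_swap_mem_psumIdeal hij (hf i j hij)) σ
  obtain ⟨p, hp⟩ := (isAntisymm_antisymm f).Delta_dvd
  have hs : p.IsSymmetric := by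
    intro σ
    have h := isAntisymm_antisymm f σ
    rw [hp, map_mul, isAntisymm_Delta n σ, smul_mul_assoc] at h
    have h2 := congrArg (fun g => ((Equiv.Perm.sign σ : ℤ) : ℂ) • g) h
    simp only [sign_smul_sign_smul] at h2
    exact mul_left_cancel₀ (Delta_ne_zero n) h2
  obtain ⟨c, hc⟩ := IsSymmetric.exists_sub_C_mem_psumIdeal hs
  have h2 := sub_mem (Ideal.mul_mem_left _ (Delta n) hc) h1
  have h3 := Ideal.mul_mem_left _ (C (n.factorial : ℂ)⁻¹) h2
  have hn : C (n.factorial : ℂ)⁻¹ * C (n.factorial : ℂ) = (1 : MvPolynomial (Fin n) ℂ) := by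
    rw [← C_mul, inv_mul_cancel₀ (by exact_mod_cast n.factorial_ne_zero), C_1]
  refine ⟨(n.factorial : ℂ)⁻¹ * c, ?_⟩
  convert h3 using 1
  rw [hp, smul_eq_C_mul, smul_eq_C_mul, C_mul]
  linear_combination -f * hn

/-! ### The pairing of f and g by the constant term of f(∂)g -/

/-- Only positivity of c and its independence of g are used, so its value is left implicit. -/
theorem exists_coeff_polyDel (α m : Fin n →₀ ℕ) : ∃ c : ℕ, 0 < c ∧ ∀ g,
    coeff m (polyDel n (monomial α 1) g) = c * coeff (m + α) g := by
  induction α using Finsupp.induction_linear generalizing m with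
  | zero => exact ⟨1, one_pos, fun g => by simp [← C_apply]⟩
  | add α β hα hβ =>
    obtain ⟨a, ha, hag⟩ := hα m
    obtain ⟨b, hb, hbg⟩ := hβ (m + α)
    refine ⟨a * b, Nat.mul_pos ha hb, fun g => ?_⟩
    rw [← one_mul (1 : ℂ), ← monomial_mul, map_mul, Module.End.mul_apply, hag, hbg, add_assoc]
    push_cast
    ring
  | single i k =>
    induction k generalizing m with
    | zero => exact ⟨1, one_pos, fun g => by simp [← C_apply]⟩
    | succ k ih =>
      obtain ⟨a, ha, hag⟩ := ih (m + Finsupp.single i 1)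
      refine ⟨(m i + 1) * a, by positivity, fun g => ?_⟩
      rw [add_comm k 1, Finsupp.single_add, ← one_mul (1 : ℂ), ← monomial_mul, map_mul,
        Module.End.mul_apply, ← X, polyDel_X, del_apply, coeff_pderiv, hag, add_assoc]
      push_cast
      ring

theorem exists_coeff_zero_polyDel (α : Fin n →₀ ℕ) : ∃ c : ℕ, 0 < c ∧ ∀ g,
    coeff 0 (polyDel n (monomial α 1) g) = c * coeff α g := by
  simpa using exists_coeff_polyDel α 0

/-- The positive factor `α!` of `∂^α g (0) = α! g_α`. -/
def weight (α : Fin n →₀ ℕ) : ℕ := (exists_coeff_zero_polyDel α).choose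

theorem weight_pos (α : Fin n →₀ ℕ) : 0 < weight α :=
  (exists_coeff_zero_polyDel α).choose_spec.1

theorem coeff_zero_polyDel_monomial (α : Fin n →₀ ℕ) (g : MvPolynomial (Fin n) ℂ) :
    coeff 0 (polyDel n (monomial α 1) g) = weight α * coeff α g :=
  (exists_coeff_zero_polyDel α).choose_spec.2 g

theorem coeff_zero_polyDel (f g : MvPolynomial (Fin n) ℂ) :
    coeff 0 (polyDel n f g) = ∑ α ∈ f.support, coeff α f * (weight α * coeff α g) := by
  conv_lhs => rw [f.as_sum]
  rw [map_sum, LinearMap.sum_apply, coeff_sum]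
  refine Finset.sum_congr rfl fun α _ => ?_
  rw [← coeff_zero_polyDel_monomial, ← mul_one (coeff α f), ← smul_eq_mul, ← smul_monomial,
    map_smul, LinearMap.smul_apply, coeff_smul]
  simp

theorem support_polyDel_monomial_le {α m β : Fin n →₀ ℕ} {g : MvPolynomial (Fin n) ℂ}
    (hg : ∀ m ∈ g.support, m ≤ β) (hm : m ∈ (polyDel n (monomial α 1) g).support) : m ≤ β := by
  obtain ⟨c, _, hc⟩ := exists_coeff_polyDel α m
  rw [mem_support_iff, hc] at hm
  exact le_self_add.trans (hg _ (mem_support_iff.2 (right_ne_zero_of_mul hm)))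

theorem star_coeff_Delta (α : Fin n →₀ ℕ) :
    starRingEnd ℂ (coeff α (Delta n)) = coeff α (Delta n) := by
  rw [← coeff_map]
  congr 1
  simp [Delta, vander, map_prod]

/-- Δ has real coefficients c_α, so the constant term is ∑ α! |c_α|² > 0. -/
theorem polyDel_Delta_Delta_ne_zero (n : ℕ) : polyDel n (Delta n) (Delta n) ≠ 0 := by
  intro h
  have h0 := coeff_zero_polyDel (Delta n) (Delta n)
  rw [h, coeff_zero] at h0
  have h1 : ((∑ α ∈ (Delta n).support, weight α * Complex.normSq (coeff α (Delta n)) : ℝ) : ℂ) =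
      0 := by
    rw [h0]
    push_cast
    refine Finset.sum_congr rfl fun α _ => ?_
    rw [← Complex.mul_conj, star_coeff_Delta]
    ring
  have h2 : 0 < ∑ α ∈ (Delta n).support, weight α * Complex.normSq (coeff α (Delta n)) :=
    Finset.sum_pos (fun α hα => mul_pos (by exact_mod_cast weight_pos α)
      (Complex.normSq_pos.2 (mem_support_iff.1 hα))) (support_nonempty.2 (Delta_ne_zero n))
  exact h2.ne' (by exact_mod_cast h1)

/-! ### Annihilator of Δ and spanning of the harmonics -/

theorem polyDel_eq_zero_of_mem_psumIdeal {h : MvPolynomial (Fin n) ℂ} (hh : h ∈ harmonics n)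
    {f : MvPolynomial (Fin n) ℂ} (hf : f ∈ psumIdeal n) : polyDel n f h = 0 := by
  induction hf using Submodule.span_induction with
  | mem x hx =>
    obtain ⟨k, hk, rfl⟩ := hx
    rw [← nabla_eq]
    simp only [harmonics, Submodule.mem_iInf, LinearMap.mem_ker] at hh
    exact hh k hk
  | zero => simp
  | add x y _ _ hx hy => rw [map_add, LinearMap.add_apply, hx, hy, add_zero]
  | smul a x _ hx => rw [smul_eq_mul, map_mul, Module.End.mul_apply, hx, map_zero]

theorem polyDel_Delta_mem_harmonics (f : MvPolynomial (Fin n) ℂ) :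
    polyDel n f (Delta n) ∈ harmonics n := by
  simp only [harmonics, Submodule.mem_iInf, LinearMap.mem_ker]
  intro k hk
  rw [nabla_eq, polyDel_apply_comm, ← nabla_eq, nabla_Delta hk, map_zero]

theorem Delta_mem_harmonics (n : ℕ) : Delta n ∈ harmonics n := by
  simpa using polyDel_Delta_mem_harmonics (1 : MvPolynomial (Fin n) ℂ)

/-- The polynomials `f` with `f(∂) Δ = 0` are those in the ideal of positive power sums. -/
theorem mem_psumIdeal_of_polyDel_Delta_eq_zero {f : MvPolynomial (Fin n) ℂ}
    (hf : polyDel n f (Delta n) = 0) : f ∈ psumIdeal n := by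
  obtain ⟨N, hN⟩ := exists_span_X_pow_le_psumIdeal n
  -- Induction on t = N - r for f in the r-th power of (x₁, …, xₙ); multiplying f by xᵢ - xⱼ raises
  -- r.
  suffices H : ∀ t r, r + t = N → ∀ f : MvPolynomial (Fin n) ℂ, polyDel n f (Delta n) = 0 →
      f ∈ Ideal.span (Set.range (X : Fin n → MvPolynomial (Fin n) ℂ)) ^ r → f ∈ psumIdeal n from
    H N 0 (zero_add N) f hf (by simp)
  clear hf f
  intro t
  induction t with
  | zero =>
    rintro r rfl f _ hf
    exact hN hf
  | succ t ih =>
    intro r hr f hf hfr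
    obtain ⟨c, hc⟩ := exists_sub_smul_Delta_mem_psumIdeal (f := f) fun i j _ => by
      refine ih (r + 1) (by omega) _ ?_ ?_
      · rw [map_mul, Module.End.mul_apply, hf, map_zero]
      · rw [pow_succ']
        exact Ideal.mul_mem_mul (sub_mem (Ideal.subset_span ⟨i, rfl⟩)
          (Ideal.subset_span ⟨j, rfl⟩)) hfr
    -- Applying f - cΔ to Δ leaves c Δ(∂)Δ = 0, so c = 0.
    have h0 := polyDel_eq_zero_of_mem_psumIdeal (Delta_mem_harmonics n) hc
    rw [map_sub, map_smul, LinearMap.sub_apply, LinearMap.smul_apply, hf, zero_sub,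
      neg_eq_zero, smul_eq_zero, or_iff_left (polyDel_Delta_Delta_ne_zero n)] at h0
    rwa [h0, zero_smul, sub_zero] at hc

/-- Only finitely many monomials divide x^β, so f = ∑ φ(x^α)/α! x^α over α ≤ β represents φ there.
-/
theorem exists_polynomial_of_functional (φ : MvPolynomial (Fin n) ℂ →ₗ[ℂ] ℂ) (β : Fin n →₀ ℕ) :
    ∃ f : MvPolynomial (Fin n) ℂ, ∀ g : MvPolynomial (Fin n) ℂ, (∀ m ∈ g.support, m ≤ β) →
      coeff 0 (polyDel n f g) = φ g := by
  refine ⟨∑ α ∈ Finset.Iic β, (φ (monomial α 1) / weight α) • monomial α 1, fun g hg => ?_⟩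
  rw [map_sum, LinearMap.sum_apply, coeff_sum]
  conv_rhs => rw [g.as_sum, map_sum]
  rw [Finset.sum_subset (fun m hm => Finset.mem_Iic.2 (hg m hm)) fun m _ hm => by
    rw [notMem_support_iff.1 hm, monomial_zero, map_zero]]
  refine Finset.sum_congr rfl fun α _ => ?_
  have hw : (weight α : ℂ) ≠ 0 := by exact_mod_cast (weight_pos α).ne'
  have hm : monomial α (coeff α g) = coeff α g • monomial α (1 : ℂ) := by
    rw [smul_monomial, smul_eq_mul, mul_one]
  rw [map_smul, LinearMap.smul_apply, coeff_smul, coeff_zero_polyDel_monomial, hm, map_smul,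
    smul_eq_mul, smul_eq_mul]
  field_simp

theorem span_delPow_Delta (n : ℕ) :
    Submodule.span ℂ (Set.range fun α : Fin n → ℕ => delPow α (Delta n)) = harmonics n := by
  refine le_antisymm ?_ fun h hh => ?_
  · rw [Submodule.span_le]
    rintro _ ⟨α, rfl⟩
    dsimp only
    rw [delPow_eq]
    exact polyDel_Delta_mem_harmonics _
  · by_contra hD
    obtain ⟨φ, hφh, hφ⟩ := Submodule.exists_le_ker_of_notMem hD
    classical
    -- The box must contain the supports of h and Δ; it then contains those of all ∂^αΔ.
    obtain ⟨f, hf⟩ := exists_polynomial_of_functional φ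
      ((h.support ∪ (Delta n).support).sup id)
    -- The constant term of ∂^α f(∂)Δ is φ(∂^αΔ) = 0 for all α, so every coefficient of f(∂)Δ
    -- vanishes.
    have hfΔ : polyDel n f (Delta n) = 0 := by
      ext α
      have h1 := coeff_zero_polyDel_monomial α (polyDel n f (Delta n))
      rw [polyDel_apply_comm, hf _ fun m hm => support_polyDel_monomial_le
        (fun m hm => Finset.le_sup (f := id) (Finset.mem_union_right _ hm)) hm,
        ← delPow_coe, LinearMap.mem_ker.1 (hφ (Submodule.subset_span ⟨α, rfl⟩))] at h1
      rw [coeff_zero]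
      exact (mul_eq_zero.1 h1.symm).resolve_left (by exact_mod_cast (weight_pos α).ne')
    have := hf h fun m hm => Finset.le_sup (f := id) (Finset.mem_union_left _ hm)
    rw [polyDel_eq_zero_of_mem_psumIdeal hh (mem_psumIdeal_of_polyDel_Delta_eq_zero hfΔ),
      coeff_zero] at this
    exact hφh this.symm

/-! ### Lifts of derivatives of Δ -/

theorem neg_dTilde_delPow_Delta {k : ℕ} (hk : 1 ≤ k) (α : Fin n → ℕ) :
    -dTilde n k (delPow α (Delta n)) =
      ∑ i with α i ≠ 0, (α i : ℂ) • delPow (α + k • Pi.single i 1) (Delta n) := by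
  have h := LinearMap.congr_fun (dTilde_delPow_commutator k α) (Delta n)
  rw [LinearMap.sub_apply, Module.End.mul_apply, Module.End.mul_apply, dTilde_Delta hk, map_zero,
    sub_zero, LinearMap.neg_apply, LinearMap.sum_apply] at h
  rw [h, neg_neg]
  rfl

theorem neg_dTilde_delPow_Delta' {k : ℕ} (hk : 1 ≤ k) (α : Fin n → ℕ) :
    -dTilde n k (delPow α (Delta n)) =
      ∑ i with α i ≠ 0,
        (α i : ℂ) • delPow (α - Pi.single i 1) ((del i ^ (k + 1)) (Delta n)) := by
  rw [neg_dTilde_delPow_Delta hk]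
  refine Finset.sum_congr rfl fun i hi => ?_
  rw [← Module.End.mul_apply, delPow_sub_single_mul_del_pow (Finset.mem_filter.1 hi).2]

theorem delPow_single (i : Fin n) : delPow (Pi.single i 1) = del i := by
  have h := delPow_coe (Finsupp.single i 1)
  rwa [Finsupp.single_eq_pi_single, ← X, polyDel_X] at h

theorem neg_dTilde_del_Delta {k : ℕ} (hk : 1 ≤ k) (i : Fin n) :
    -dTilde n k (del i (Delta n)) = (del i ^ (k + 1)) (Delta n) := by
  rw [← delPow_single, neg_dTilde_delPow_Delta' hk, Finset.sum_eq_single_of_mem i (by simp)]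
  · rw [Pi.single_eq_same, Nat.cast_one, one_smul, tsub_self, delPow_eq_prod,
      delPow_single]
    simp
  · intro j hj hji
    simp [hji] at hj

theorem isFirstOrderLift_iff {f₀ f₁ : MvPolynomial (Fin n) ℂ} :
    IsFirstOrderLift f₀ f₁ ↔ nabla n 1 f₁ = -dTilde n 1 f₀ ∧ nabla n 2 f₁ = -dTilde n 2 f₀ := by
  simp [IsFirstOrderLift]

theorem one_le_of_mem {k : ℕ} (hk : k ∈ ({1, 2} : Set ℕ)) : 1 ≤ k := by
  rcases hk with rfl | rfl <;> norm_num

theorem IsFirstOrderLift.sign_smul_rename {i : Fin n} {f : MvPolynomial (Fin n) ℂ}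
    (hf : IsFirstOrderLift (del i (Delta n)) f) (σ : Equiv.Perm (Fin n)) :
    IsFirstOrderLift (del (σ i) (Delta n)) (((Equiv.Perm.sign σ : ℤ) : ℂ) • rename σ f) := by
  intro k hk
  rw [map_smul, ← rename_nabla, hf k hk, map_neg, rename_dTilde, rename_del,
    isAntisymm_Delta n σ, map_smul, map_smul, smul_neg, sign_smul_sign_smul]

theorem nabla_delPow (k : ℕ) (α : Fin n → ℕ) (f : MvPolynomial (Fin n) ℂ) :
    nabla n k (delPow α f) = delPow α (nabla n k f) := by
  rw [nabla_eq, delPow_eq, polyDel_apply_comm]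

/-- ∇ₖ commutes with ∂^(α-vᵢ), and -D̃ₖ∂^αΔ is the same combination of the ∂ᵢᵏ⁺¹Δ = -D̃ₖ∂ᵢΔ. -/
theorem isFirstOrderLift_sum_delPow {f : Fin n → MvPolynomial (Fin n) ℂ}
    (hf : ∀ i, IsFirstOrderLift (del i (Delta n)) (f i)) (α : Fin n → ℕ) :
    IsFirstOrderLift (delPow α (Delta n))
      (∑ i with α i ≠ 0, (α i : ℂ) • delPow (α - Pi.single i 1) (f i)) := by
  intro k hk
  rw [neg_dTilde_delPow_Delta' (one_le_of_mem hk), map_sum]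
  refine Finset.sum_congr rfl fun i _ => ?_
  rw [map_smul, nabla_delPow, hf i k hk, neg_dTilde_del_Delta (one_le_of_mem hk)]

theorem IsFirstOrderLift.exists_lift_of_mem_harmonics {i : Fin n} {f : MvPolynomial (Fin n) ℂ}
    (hf : IsFirstOrderLift (del i (Delta n)) f) {f₀ : MvPolynomial (Fin n) ℂ}
    (h : f₀ ∈ harmonics n) : ∃ f₁, IsFirstOrderLift f₀ f₁ := by
  rw [← span_delPow_Delta] at h
  induction h using Submodule.span_induction with
  | mem x hx =>
    obtain ⟨α, rfl⟩ := hx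
    have hj : ∀ j, ∃ g, IsFirstOrderLift (del j (Delta n)) g := fun j =>
      ⟨_, by simpa using hf.sign_smul_rename (Equiv.swap i j)⟩
    choose g hg using hj
    exact ⟨_, isFirstOrderLift_sum_delPow hg α⟩
  | zero => exact ⟨0, fun k _ => by simp⟩
  | add x y _ _ hx hy =>
    obtain ⟨u, hu⟩ := hx
    obtain ⟨v, hv⟩ := hy
    exact ⟨u + v, fun k hk => by rw [map_add, hu k hk, hv k hk, map_add, neg_add]⟩
  | smul a x _ hx =>
    obtain ⟨u, hu⟩ := hx
    exact ⟨a • u, fun k hk => by rw [map_smul, hu k hk, map_smul, smul_neg]⟩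

/-! ### Linear forms times harmonics -/

theorem elem_natCast (j : Fin n) (k : ℕ) :
    elem j (k : ℤ) = ∑ T ∈ (Finset.univ.erase j).powersetCard k, ∏ i ∈ T, X i := by
  rw [elem, if_neg (by omega), Int.toNat_natCast]

theorem elem_one (j : Fin n) : elem j 1 = ∑ i ∈ Finset.univ.erase j, X i := by
  rw [← Nat.cast_one, elem_natCast, Finset.powersetCard_one, Finset.sum_map]
  simp

theorem pderiv_linear (a b : ℂ) (i j : Fin n) :
    pderiv i (C a * X j + C b * elem j 1) = C (if i = j then a else b) := by
  rw [elem_one, map_add, pderiv_C_mul, pderiv_C_mul, map_sum]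
  rcases eq_or_ne i j with rfl | h
  · rw [pderiv_X_self, Finset.sum_eq_zero, if_pos rfl, mul_one, mul_zero, add_zero]
    exact fun k hk => pderiv_X_of_ne (Finset.ne_of_mem_erase hk)
  · rw [pderiv_X_of_ne h.symm, if_neg h, Finset.sum_eq_single_of_mem i (by simp [h])]
    · simp
    · exact fun k _ hk => pderiv_X_of_ne hk

theorem nabla_one_linear_mul (a b : ℂ) (j : Fin n) (g : MvPolynomial (Fin n) ℂ) :
    nabla n 1 ((C a * X j + C b * elem j 1) * g) =
      (a + (n - 1) * b) • g + (C a * X j + C b * elem j 1) * nabla n 1 g := by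
  have hs : ∑ i : Fin n, (if i = j then a else b) = a + (n - 1) * b := by
    have : ∀ i : Fin n, (if i = j then a else b) = (if i = j then a - b else 0) + b := by
      intro i
      split_ifs <;> ring
    simp only [this, Finset.sum_add_distrib, Finset.sum_ite_eq', Finset.mem_univ, if_true,
      Finset.sum_const, Finset.card_univ, Fintype.card_fin, nsmul_eq_mul]
    ring
  simp only [nabla_apply, pow_one, del_apply, pderiv_mul, pderiv_linear, Finset.sum_add_distrib,
    ← Finset.sum_mul, ← Finset.mul_sum, ← map_sum, hs, smul_eq_C_mul]

/-- A linear form has no second derivatives; the cross terms 2∑ᵢ cᵢ∂ᵢg, with cⱼ = a and cᵢ = b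
otherwise, split as 2(a - b)∂ⱼg + 2b∇₁g. -/
theorem nabla_two_linear_mul (a b : ℂ) (j : Fin n) (g : MvPolynomial (Fin n) ℂ) :
    nabla n 2 ((C a * X j + C b * elem j 1) * g) =
      (2 * (a - b)) • del j g + (2 * b) • nabla n 1 g +
        (C a * X j + C b * elem j 1) * nabla n 2 g := by
  have hs : ∑ i : Fin n, C (if i = j then a else b) * pderiv i g =
      C (a - b) * pderiv j g + C b * ∑ i, pderiv i g := by
    have : ∀ i : Fin n, C (if i = j then a else b) * pderiv i g =
        (if i = j then C (a - b) * pderiv i g else 0) + C b * pderiv i g := by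
      intro i
      split_ifs
      · rw [C_sub]; ring
      · ring
    simp only [this, Finset.sum_add_distrib, Finset.sum_ite_eq', Finset.mem_univ, if_true,
      Finset.mul_sum]
  have h2 : ∀ i : Fin n, (del i ^ 2) ((C a * X j + C b * elem j 1) * g) =
      2 * (C (if i = j then a else b) * pderiv i g) +
        (C a * X j + C b * elem j 1) * (del i ^ 2) g := by
    intro i
    rw [pow_two, Module.End.mul_apply, Module.End.mul_apply]
    rw [del_apply, del_apply, pderiv_mul, pderiv_linear, map_add, del_apply, del_apply, pderiv_C_mul,
      pderiv_mul, pderiv_linear]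
    ring
  simp only [nabla_apply, h2, Finset.sum_add_distrib, ← Finset.mul_sum, hs, smul_eq_C_mul, pow_one,
    del_apply, C_mul, map_ofNat]
  ring

theorem nabla_linear_mul_delPow_Delta (a b : ℂ) (j : Fin n) (α : Fin n → ℕ) :
    nabla n 1 ((C a * X j + C b * elem j 1) * delPow α (Delta n)) =
        (a + (n - 1) * b) • delPow α (Delta n) ∧
      nabla n 2 ((C a * X j + C b * elem j 1) * delPow α (Delta n)) =
        (2 * (a - b)) • del j (delPow α (Delta n)) := by
  have h : ∀ k, 1 ≤ k → nabla n k (delPow α (Delta n)) = 0 := fun k hk => by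
    rw [nabla_delPow, nabla_Delta hk, map_zero]
  rw [nabla_one_linear_mul, nabla_two_linear_mul, h 1 le_rfl, h 2 one_le_two]
  simp

theorem exists_linear_mul_delPow_Delta [NeZero n] (c d : ℂ) : ∃ a b : ℂ,
    ∀ (j : Fin n) (α : Fin n → ℕ),
      nabla n 1 ((C a * X j + C b * elem j 1) * delPow α (Delta n)) = c • delPow α (Delta n) ∧
      nabla n 2 ((C a * X j + C b * elem j 1) * delPow α (Delta n)) =
        d • del j (delPow α (Delta n)) := by
  have hn : (n : ℂ) ≠ 0 := NeZero.ne _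
  -- Solution of a + (n-1)b = c, 2(a - b) = d: subtracting a - b = d/2 gives nb = c - d/2.
  refine ⟨d / 2 + (c - d / 2) / n, (c - d / 2) / n, fun j α => ?_⟩
  have h := nabla_linear_mul_delPow_Delta (d / 2 + (c - d / 2) / n) ((c - d / 2) / n) j α
  convert h using 3
  · field_simp
    ring
  · ring

/-! ### The explicit lift -/

theorem Delta_eq_vander_erase_mul [NeZero n] :
    Delta n = vander (Finset.univ.erase (0 : Fin n)) *
      ∏ j ∈ Finset.univ.erase (0 : Fin n), (X 0 - X j) := by
  rw [Delta, vander, ← Finset.prod_erase_mul _ _ (Finset.mem_univ 0), vander]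
  congr 1
  · refine Finset.prod_congr rfl fun i _ => Finset.prod_congr ?_ fun _ _ => rfl
    ext j
    simp only [Finset.mem_filter, Finset.mem_univ, true_and, Finset.mem_erase, and_true,
      iff_and_self]
    rintro h rfl
    exact absurd h (Fin.not_lt_zero i)
  · refine Finset.prod_congr ?_ fun _ _ => rfl
    ext j
    simp [Fin.pos_iff_ne_zero]

theorem prod_X_zero_sub_X [NeZero n] :
    ∏ j ∈ Finset.univ.erase (0 : Fin n), (X 0 - X j : MvPolynomial (Fin n) ℂ) =
      ∑ r ∈ Finset.range n,
        C ((-1) ^ (n - 1 - r)) * elem (0 : Fin n) ((n : ℤ) - 1 - r) * X 0 ^ r := by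
  have hn : 1 ≤ n := NeZero.one_le
  have hc : (Finset.univ.erase (0 : Fin n)).card = n - 1 := by simp
  -- Subsets are grouped by size; reflecting the sum makes the index r the exponent of x₁.
  rw [Finset.prod_sub, Finset.sum_powerset, hc, Nat.sub_add_cancel hn, ← Finset.sum_range_reflect]
  refine Finset.sum_congr rfl fun r hr => ?_
  rw [Finset.mem_range] at hr
  rw [show (n : ℤ) - 1 - r = ((n - 1 - r : ℕ) : ℤ) by omega, elem_natCast, Finset.mul_sum,
    Finset.sum_mul]
  refine Finset.sum_congr rfl fun T hT => ?_
  rw [Finset.mem_powersetCard] at hT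
  rw [Finset.prod_const, Finset.card_sdiff_of_subset hT.1, hT.2, hc, Nat.sub_sub_self (by omega)]
  simp only [map_pow, map_neg, map_one]
  ring

theorem pderiv_elem (j : Fin n) (k : ℤ) : pderiv j (elem j k) = 0 := by
  refine pderiv_eq_zero_of_notMem_vars fun h => ?_
  classical
  rw [elem] at h
  split_ifs at h
  · simp at h
  · obtain ⟨T, hT, h⟩ := Finset.mem_biUnion.1 (vars_sum_subset _ _ h)
    obtain ⟨i, hi, h⟩ := Finset.mem_biUnion.1 (vars_prod _ h)
    rw [vars_X, Finset.mem_singleton] at h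
    subst h
    exact Finset.notMem_erase _ _ ((Finset.mem_powersetCard.1 hT).1 hi)

theorem pderiv_vander_erase (j : Fin n) : pderiv j (vander (Finset.univ.erase j)) = 0 := by
  refine pderiv_eq_zero_of_notMem_vars fun h => ?_
  obtain ⟨i, hi, h⟩ := Finset.mem_biUnion.1 (vars_prod _ h)
  obtain ⟨k, hk, h⟩ := Finset.mem_biUnion.1 (vars_prod _ h)
  rcases Finset.mem_union.1 (vars_sub_subset _ h) with h | h <;>
    rw [vars_X, Finset.mem_singleton] at h <;> subst h
  · exact Finset.notMem_erase _ _ hi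
  · exact Finset.notMem_erase _ _ (Finset.mem_filter.1 hk).1

theorem del_sq_mul_X_pow {f : MvPolynomial (Fin n) ℂ} {i : Fin n} (hf : pderiv i f = 0) (r : ℕ) :
    (del i ^ 2) (f * X i ^ r) = C ((r * (r - 1) : ℕ) : ℂ) * f * X i ^ (r - 2) := by
  rw [pow_two, Module.End.mul_apply, del_apply, del_apply, pderiv_mul, hf, zero_mul, zero_add,
    pderiv_pow, pderiv_X_self, mul_one, ← map_natCast C, pderiv_mul, hf, zero_mul, zero_add,
    pderiv_C_mul, pderiv_pow, pderiv_X_self, mul_one, Nat.sub_sub, ← map_natCast C, Nat.cast_mul,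
    C_mul]
  ring

theorem del_zero_sq_Delta [NeZero n] :
    (del (0 : Fin n) ^ 2) (Delta n) = vander (Finset.univ.erase (0 : Fin n)) *
      ∑ r ∈ Finset.range n, C ((r * (r - 1) : ℕ) : ℂ) *
        (C ((-1) ^ (n - 1 - r)) * elem (0 : Fin n) ((n : ℤ) - 1 - r)) * X 0 ^ (r - 2) := by
  have hv : ∀ f, (del (0 : Fin n) ^ 2) (vander (Finset.univ.erase (0 : Fin n)) * f) =
      vander (Finset.univ.erase (0 : Fin n)) * (del (0 : Fin n) ^ 2) f := fun f => by
    rw [pow_two, Module.End.mul_apply, Module.End.mul_apply]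
    simp only [del_apply, pderiv_mul, pderiv_vander_erase, zero_mul, zero_add]
  rw [Delta_eq_vander_erase_mul, hv, prod_X_zero_sub_X, map_sum]
  congr 1
  refine Finset.sum_congr rfl fun r _ => del_sq_mul_X_pow ?_ r
  rw [pderiv_C_mul, pderiv_elem, mul_zero]

theorem explicitLift_eq [NeZero n] :
    explicitLift n = (C ((n + 1) / (2 * n) : ℂ) * X 0 + C (1 / (2 * n) : ℂ) * elem (0 : Fin n) 1) *
      (del (0 : Fin n) ^ 2) (Delta n) := by
  have hn : 1 ≤ n := NeZero.one_le
  have hn0 : (n : ℂ) ≠ 0 := NeZero.ne _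
  rw [del_zero_sq_Delta, mul_left_comm, explicitLift]
  congr 1
  set t : ℕ → MvPolynomial (Fin n) ℂ := fun r => C ((r * (r - 1) : ℕ) : ℂ) *
        (C ((-1) ^ (n - 1 - r)) * elem (0 : Fin n) ((n : ℤ) - 1 - r)) * X 0 ^ (r - 2) with ht
  have ht0 : t 0 = 0 := by simp [ht]
  have ht1 : t 1 = 0 := by simp [ht]
  have htn : t n = 0 := by simp [ht, elem]
  -- To collect x₁ˢ, the a x₁ part needs r = s + 1 and the b e₁ part r = s + 2; vanishing of `t` at
  -- 0, 1 and n makes both ranges `n - 1`.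
  have h1 : ∑ r ∈ Finset.range n, t r = ∑ s ∈ Finset.range (n - 1), t (s + 1) := by
    rw [← add_zero (∑ s ∈ Finset.range (n - 1), t (s + 1)), ← ht0, ← Finset.sum_range_succ',
      Nat.sub_add_cancel hn]
  have h2 : ∑ r ∈ Finset.range n, t r = ∑ s ∈ Finset.range (n - 1), t (s + 2) := by
    rw [← add_zero (∑ r ∈ Finset.range n, t r), ← htn, ← Finset.sum_range_succ,
      show n + 1 = n - 1 + 1 + 1 by omega, Finset.sum_range_succ', Finset.sum_range_succ', ht0, ht1,
      add_zero, add_zero]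
  rw [add_mul]
  conv_rhs =>
    congr
    · rw [h1]
    · rw [h2]
  rw [Finset.mul_sum, Finset.mul_sum, ← Finset.sum_add_distrib]
  refine Finset.sum_congr rfl fun s hs => ?_
  rw [Finset.mem_range] at hs
  have e1 : C ((n + 1) / (2 * n) : ℂ) * X 0 * t (s + 1) =
      C ((-1 : ℂ) ^ (n - 2 - s) / (n : ℂ)) * (C (((n + 1) * (s + 1).choose 2 : ℕ) : ℂ) *
        elem (0 : Fin n) ((n : ℤ) - 2 - s)) * X 0 ^ s := by
    have hX : C (((s + 1) * (s + 1 - 1) : ℕ) : ℂ) * (X 0 * X 0 ^ (s + 1 - 2)) =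
        C (((s + 1) * s : ℕ) : ℂ) * (X (0 : Fin n)) ^ s := by
      rcases s with _ | s
      · simp
      · rw [← pow_succ']
        rfl
    have hC : C ((n + 1) / (2 * n) : ℂ) * C (((s + 1) * s : ℕ) : ℂ) * C ((-1) ^ (n - 1 - (s + 1))) =
        (C ((-1 : ℂ) ^ (n - 2 - s) / (n : ℂ)) * C (((n + 1) * (s + 1).choose 2 : ℕ) : ℂ) :
          MvPolynomial (Fin n) ℂ) := by
      rw [← C_mul, ← C_mul, ← C_mul, show n - 1 - (s + 1) = n - 2 - s by omega]
      congr 1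
      push_cast [Nat.cast_choose_two]
      field_simp
      ring
    rw [ht, show (n : ℤ) - 2 - s = (n : ℤ) - 1 - (s + 1 : ℕ) by omega]
    linear_combination C ((n + 1) / (2 * n) : ℂ) * C ((-1) ^ (n - 1 - (s + 1))) *
      elem (0 : Fin n) ((n : ℤ) - 1 - (s + 1 : ℕ)) * hX +
      elem (0 : Fin n) ((n : ℤ) - 1 - (s + 1 : ℕ)) * X 0 ^ s * hC
  have e2 : C (1 / (2 * n) : ℂ) * elem (0 : Fin n) 1 * t (s + 2) =
      -(C ((-1 : ℂ) ^ (n - 2 - s) / (n : ℂ)) * (C (((s + 2).choose 2 : ℕ) : ℂ) *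
        elem (0 : Fin n) ((n : ℤ) - 3 - s) * elem (0 : Fin n) 1) * X 0 ^ s) := by
    rw [ht, show (n : ℤ) - 3 - s = (n : ℤ) - 1 - (s + 2 : ℕ) by omega]
    -- For s = n - 2 the truncated sign exponents no longer match, but there e₋₁ = 0.
    rcases Nat.lt_or_ge (s + 2) n with h | h
    · have hC : C (1 / (2 * n) : ℂ) * C (((s + 2) * (s + 2 - 1) : ℕ) : ℂ) *
          C ((-1) ^ (n - 1 - (s + 2))) =
          (-(C ((-1 : ℂ) ^ (n - 2 - s) / (n : ℂ)) * C (((s + 2).choose 2 : ℕ) : ℂ)) :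
            MvPolynomial (Fin n) ℂ) := by
        rw [← C_mul, ← C_mul, ← C_mul, ← C_neg, show n - 2 - s = n - 1 - (s + 2) + 1 by omega,
          show s + 2 - 1 = s + 1 by omega]
        congr 1
        push_cast [Nat.cast_choose_two]
        field_simp
        ring
      simp only [Nat.add_sub_cancel]
      linear_combination elem (0 : Fin n) ((n : ℤ) - 1 - (s + 2 : ℕ)) * elem (0 : Fin n) 1 *
        X 0 ^ s * hC
    · have : elem (0 : Fin n) ((n : ℤ) - 1 - (s + 2 : ℕ)) = 0 := by
        rw [elem, if_pos (by omega)]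
      simp only [this, mul_zero, zero_mul, neg_zero]
  rw [e1, e2]
  ring

theorem isFirstOrderLift_explicitLift [NeZero n] :
    IsFirstOrderLift (del (0 : Fin n) (Delta n)) (explicitLift n) := by
  have hn : (n : ℂ) ≠ 0 := NeZero.ne _
  have hd : delPow (2 • Pi.single (0 : Fin n) 1) = del (0 : Fin n) ^ 2 := by
    rw [delPow_eq_prod, Finset.prod_eq_single_of_mem 0 (Finset.mem_univ _)]
    · simp
    · intro i _ hi
      simp [hi]
  -- These values solve a + (n-1)b = 1 and 2(a - b) = 1.
  have h := nabla_linear_mul_delPow_Delta ((n + 1) / (2 * n)) (1 / (2 * n)) (0 : Fin n)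
    (2 • Pi.single (0 : Fin n) 1)
  rw [hd, ← explicitLift_eq] at h
  rw [isFirstOrderLift_iff, neg_dTilde_del_Delta le_rfl, neg_dTilde_del_Delta one_le_two, h.1, h.2]
  constructor
  · rw [show ((n : ℂ) + 1) / (2 * n) + (n - 1) * (1 / (2 * n)) = 1 by field_simp; ring, one_smul]
  · rw [show 2 * (((n : ℂ) + 1) / (2 * n) - 1 / (2 * n)) = 1 by field_simp; ring, one_smul,
      pow_succ' _ 2]
    rfl

end QHarmonic

end

theorem mainTheorem4 (n : ℕ) [NeZero n] :
    -- every harmonic polynomial has a first-order lift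
    (∀ f₀ ∈ QHarmonic.harmonics n, ∃ f₁ : MvPolynomial (Fin n) ℂ,
      QHarmonic.IsFirstOrderLift f₀ f₁) ∧
    -- the derivatives of the Vandermonde determinant span the harmonics
    Submodule.span ℂ (Set.range fun α : Fin n → ℕ => QHarmonic.delPow α (QHarmonic.Delta n)) =
      QHarmonic.harmonics n ∧
    -- the commutator of `D̃ₖ` and `∂^α`
    (∀ (k : ℕ) (α : Fin n → ℕ),
      QHarmonic.dTilde n k * QHarmonic.delPow α - QHarmonic.delPow α * QHarmonic.dTilde n k =
        -∑ i with α i ≠ 0, (α i : ℂ) • QHarmonic.delPow (α + k • Pi.single i 1)) ∧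
    -- its consequences for the Vandermonde determinant
    (∀ k : ℕ, 1 ≤ k →
      QHarmonic.dTilde n k (QHarmonic.Delta n) = 0 ∧
      ∀ α : Fin n → ℕ,
        -QHarmonic.dTilde n k (QHarmonic.delPow α (QHarmonic.Delta n)) =
          ∑ i with α i ≠ 0,
            (α i : ℂ) • QHarmonic.delPow (α + k • Pi.single i 1) (QHarmonic.Delta n) ∧
        -QHarmonic.dTilde n k (QHarmonic.delPow α (QHarmonic.Delta n)) =
          ∑ i with α i ≠ 0,
            (α i : ℂ) • QHarmonic.delPow (α - Pi.single i 1)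
              ((QHarmonic.del i ^ (k + 1)) (QHarmonic.Delta n))) ∧
    -- a lift of `∂₁Δ` gives lifts of all `∂ᵢΔ` by permuting the variables
    (∀ f : MvPolynomial (Fin n) ℂ,
      QHarmonic.IsFirstOrderLift (QHarmonic.del 0 (QHarmonic.Delta n)) f →
      ∀ σ : Equiv.Perm (Fin n),
        QHarmonic.IsFirstOrderLift (QHarmonic.del (σ 0) (QHarmonic.Delta n))
          (((Equiv.Perm.sign σ : ℤ) : ℂ) • MvPolynomial.rename σ f)) ∧
    -- lifts of all `∂ᵢΔ` give lifts of all `∂^αΔ`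
    (∀ f : Fin n → MvPolynomial (Fin n) ℂ,
      (∀ i, QHarmonic.IsFirstOrderLift (QHarmonic.del i (QHarmonic.Delta n)) (f i)) →
      ∀ α : Fin n → ℕ,
        QHarmonic.IsFirstOrderLift (QHarmonic.delPow α (QHarmonic.Delta n))
          (∑ i with α i ≠ 0, (α i : ℂ) • QHarmonic.delPow (α - Pi.single i 1) (f i))) ∧
    -- the solutions `(a xⱼ + b e₁⁽ʲ⁾) ∂^αΔ`
    (∀ c d : ℂ, ∃ a b : ℂ, ∀ (j : Fin n) (α : Fin n → ℕ),
      QHarmonic.nabla n 1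
          ((MvPolynomial.C a * MvPolynomial.X j + MvPolynomial.C b * QHarmonic.elem j 1) *
            QHarmonic.delPow α (QHarmonic.Delta n)) =
        c • QHarmonic.delPow α (QHarmonic.Delta n) ∧
      QHarmonic.nabla n 2
          ((MvPolynomial.C a * MvPolynomial.X j + MvPolynomial.C b * QHarmonic.elem j 1) *
            QHarmonic.delPow α (QHarmonic.Delta n)) =
        d • QHarmonic.del j (QHarmonic.delPow α (QHarmonic.Delta n))) ∧
    -- the explicit lift of `∂₁Δ`
    QHarmonic.IsFirstOrderLift (QHarmonic.del 0 (QHarmonic.Delta n))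
      (QHarmonic.explicitLift n) := by
  have hlift := QHarmonic.isFirstOrderLift_explicitLift (n := n)
  exact ⟨fun f₀ h => hlift.exists_lift_of_mem_harmonics h, QHarmonic.span_delPow_Delta n,
    QHarmonic.dTilde_delPow_commutator,
    fun k hk => ⟨QHarmonic.dTilde_Delta hk, fun α =>
      ⟨QHarmonic.neg_dTilde_delPow_Delta hk α, QHarmonic.neg_dTilde_delPow_Delta' hk α⟩⟩,
    fun f hf σ => hf.sign_smul_rename σ, fun f hf α => QHarmonic.isFirstOrderLift_sum_delPow hf α,
    QHarmonic.exists_linear_mul_delPow_Delta, hlift⟩
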